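/- For a complex polynomial $P$ with zeroes $x_1,\dots,x_k$ and a complex polynomial $Q$ with zeroes $y_1,\dots,y_d$ (all zeroes listed with multiplicity) such that $x_i\ne y_j$ for all $i,j$, let $\mathrm{PER}(P(x),Q(y))$ be the permanent of the $k\times d$ matrix $\bigl(1/(x_i-y_j)\bigr)_{1\le i\le k,\,1\le j\le d}$, that is, the sum of all products of $k$ entries of the matrix, one from each row, no two of them from the same column (so it is $0$ if $k>d$). Let $(\alpha)_k=\alpha(\alpha+1)\cdots(\alpha+k-1)$ for $k\ge1$, $(\alpha)_0=1$ and $(\alpha)_{-1}=1/(\alpha-1)$. **Theorem.** Let $n$ and $m$ be positive integers and let $a$ be a complex number with $mn+2a-1\neq0$; if $n=1$, assume also that $a+m-1\ne0$. Then $x^n-1$ and $\sum_{\ell=0}^{mn-1}(\ell+a)y^{\ell}$ have no common zero, and $$\mathrm{PER}\Bigl(x^n-1,\ \sum_{\ell=0}^{mn-1}(\ell+a)y^{\ell}\Bigr)=(-1)^{n-1}\,\frac{n(m-1)\,V_n(a,m)}{6\,(mn+2a-1)}\,\bigl(a+(m-1)n+1\bigr)_{n-2},$$ where $V_n(a,m)$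 is the polynomial $$V_n(a,m)=1-6a+6a^2+n-2an-5mn+10amn-mn^2+4m^2n^2 .$$ -/

import Mathlib

open Polynomial

/-- The permanent of a (possibly rectangular) matrix `A` with rows indexed by `ι` and columns
indexed by `κ`: the sum of all products of entries, one from each row, no two of which are taken
from the same column. It is an empty sum if there are more rows than columns. -/
noncomputable def rectPermanent {ι κ : Type*} [Fintype ι] [Fintype κ] (A : Matrix ι κ ℂ) : ℂ :=
  letI : Fintype (ι ↪ κ) := Fintype.ofFinite _
  ∑ f : ι ↪ κ, ∏ i, A i (f i)

/-- The Scott-type permanent of two complex polynomials `P` and `Q`: the permanent of the matrix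
`(1 / (x_i - y_j))`, where `x_1, …, x_n` are the zeroes of `P` and `y_1, …, y_d` are the zeroes
of `Q`. The index types `P.roots.ToType` and `Q.roots.ToType` enumerate the zeroes, each one as
often as its multiplicity. -/
noncomputable def scottPER (P Q : ℂ[X]) : ℂ :=
  rectPermanent (Matrix.of fun (i : P.roots.ToType) (j : Q.roots.ToType) => 1 / (i.1 - j.1))

/-- The shifted factorial `(α)_k`: it is `α (α + 1) ⋯ (α + k - 1)` for `k ≥ 1`, it is `1` for
`k = 0`, and for `k < 0` it is given by the usual extension
`(α)_k = 1 / ((α - 1) (α - 2) ⋯ (α + k))`, so that `(α)_{k+1} = (α)_k (α + k)`. -/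
noncomputable def shiftedFactorial (α : ℂ) : ℤ → ℂ
  | Int.ofNat k => ∏ i ∈ Finset.range k, (α + i)
  | Int.negSucc k => 1 / ∏ i ∈ Finset.range (k + 1), (α - (i + 1))

/-- The polynomial `V_n(a, m)`. -/
noncomputable def polyV (n : ℕ) (a : ℂ) (m : ℕ) : ℂ :=
  1 - 6 * a + 6 * a ^ 2 + n - 2 * a * n - 5 * m * n + 10 * a * m * n - m * n ^ 2
    + 4 * m ^ 2 * n ^ 2

/-- The polynomial `∑_{ℓ = 0}^{mn - 1} (ℓ + a) y ^ ℓ`. -/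
noncomputable def arithPoly (m n : ℕ) (a : ℂ) : ℂ[X] :=
  ∑ l ∈ Finset.range (m * n), C ((l : ℂ) + a) * X ^ l

/-- Two enumerations of the same multiset differ by a bijection of the index types. -/
theorem exists_toType_equiv {α : Type*} [Fintype α] (s : Multiset ℂ) (z : α → ℂ)
    (hz : Finset.univ.val.map z = s) : ∃ e : s.ToType ≃ α, ∀ i, z (e i) = i.1 := by
  classical
  have h (c : ℂ) : Nonempty (Fin (s.count c) ≃ {b : α // z b = c}) := by
    refine ⟨(Fintype.equivFinOfCardEq ?_).symm⟩
    rw [← hz, Multiset.count_map, Fintype.card_subtype, Finset.card_def, Finset.filter_val]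
    simp only [eq_comm]
  refine ⟨(Equiv.sigmaCongrRight fun c => (h c).some).trans (Equiv.sigmaFiberEquiv z), ?_⟩
  rintro ⟨c, i⟩
  exact ((h c).some i).2

/-- The Scott-type permanent can be computed with any enumeration of the zeroes (with
multiplicity). -/
theorem scottPER_eq {ι κ : Type*} [Fintype ι] [Fintype κ] (P Q : ℂ[X]) (x : ι → ℂ) (y : κ → ℂ)
    (hx : Finset.univ.val.map x = P.roots) (hy : Finset.univ.val.map y = Q.roots) :
    scottPER P Q = rectPermanent (Matrix.of fun i j => 1 / (x i - y j)) := by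
  obtain ⟨e, he⟩ := exists_toType_equiv P.roots x hx
  obtain ⟨g, hg⟩ := exists_toType_equiv Q.roots y hy
  unfold scottPER rectPermanent
  let : Fintype (P.roots.ToType ↪ Q.roots.ToType) := Fintype.ofFinite _
  let : Fintype (ι ↪ κ) := Fintype.ofFinite _
  refine Fintype.sum_equiv (Equiv.embeddingCongr e g) _ _ fun f => ?_
  refine Fintype.prod_equiv e _ _ fun i => ?_
  simp [he, hg, Equiv.embeddingCongr]

/-! Lascoux's formula turns the permanent of `1 / (x i - y j)` into a determinant `det M` of size n
that sees the `y j` only through the sums Q'/Q at the `x i`. It is proved by adding the `y j` one at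
a time: expanding the permanent along the new column matches the partial fraction expansion of the
determinant in the new `y` (`det_add_diagonal_inv_sub`).

When the `x i` are the n-th roots of unity, the transpose of `M` times `diag x` is, in terms of
values at the roots, the operator f ↦ (x Q'/Q) f - X f' modulo X^n - 1 (`sum_pow_add_pow_div_sub`).
For the present Q one has x Q'/Q = c - 2/(x - 1), c = mn + a - 2, at every root x ≠ 1; only the
value at 1 is exceptional. Hence, in the monomial basis, the operator is an upper triangular matrix
with diagonal entries c - k plus a matrix of rank two, and for n ≥ 2 its determinant reduces to a 2
× 2 one. Two of the n factors c - k cancel; the remaining n - 2 form the shifted factorial, and the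
2 × 2 determinant yields (m - 1) V_n. -/

/-- Partial fraction expansion of a product of functions that are affine in `1 / (x i - y)`. -/
theorem prod_add_div_sub_eq {ι : Type*} [DecidableEq ι] (S : Finset ι) (x a b : ι → ℂ)
    (hx : Function.Injective x) (y : ℂ) (hy : ∀ i, x i ≠ y) :
    ∏ i ∈ S, (a i + b i * (1 / (x i - y))) = ∏ i ∈ S, a i +
      ∑ i ∈ S, 1 / (x i - y) * (b i * ∏ k ∈ S.erase i, (a k + b k * (1 / (x k - x i)))) := by
  -- the points `x i` with `i ∉ S` are allowed as values of `y`
  suffices H : ∀ y, (∀ i ∈ S, x i ≠ y) → ∏ i ∈ S, (a i + b i * (1 / (x i - y))) =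
      ∏ i ∈ S, a i + ∑ i ∈ S, 1 / (x i - y) *
        (b i * ∏ k ∈ S.erase i, (a k + b k * (1 / (x k - x i)))) from H y fun i _ => hy i
  clear hy y
  induction S using Finset.induction_on with
  | empty => simp
  | insert j S hj ih =>
    intro y hy
    have hS : ∀ i ∈ S, x i ≠ y := fun i hi => hy i (Finset.mem_insert_of_mem hi)
    have hj' : ∀ i ∈ S, x i ≠ x j := fun i hi h => hj (hx h ▸ hi)
    have e (i) (hi : i ∈ S) : ∏ k ∈ (insert j S).erase i, (a k + b k * (1 / (x k - x i))) =
        (a j + b j * (1 / (x j - x i))) * ∏ k ∈ S.erase i, (a k + b k * (1 / (x k - x i))) := by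
      rw [Finset.erase_insert_of_ne (by rintro rfl; exact hj hi),
        Finset.prod_insert (fun h => hj (Finset.mem_of_mem_erase h))]
    rw [Finset.prod_insert hj, Finset.prod_insert hj, Finset.sum_insert hj,
      Finset.erase_insert hj, ih (x j) hj',
      Finset.sum_congr rfl fun i hi =>
        congrArg (fun z => 1 / (x i - y) * (b i * z)) (e i hi), ih y hS]
    simp only [mul_add, add_mul, Finset.mul_sum]
    have key : ∑ i ∈ S, b j * (1 / (x j - y)) * (1 / (x i - y) *
          (b i * ∏ k ∈ S.erase i, (a k + b k * (1 / (x k - x i))))) =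
        ∑ i ∈ S, (1 / (x j - y) * (b j * (1 / (x i - x j) *
          (b i * ∏ k ∈ S.erase i, (a k + b k * (1 / (x k - x i)))))) +
         1 / (x i - y) * (b i * (b j * (1 / (x j - x i)) *
          ∏ k ∈ S.erase i, (a k + b k * (1 / (x k - x i)))))) := by
      refine Finset.sum_congr rfl fun i hi => ?_
      have h1 := sub_ne_zero.2 (hS i hi)
      have h2 := sub_ne_zero.2 (hj' i hi)
      have h3 := sub_ne_zero.2 (hj' i hi).symm
      have h4 := sub_ne_zero.2 (hy j (Finset.mem_insert_self j S))
      -- Two simple poles at distinct points separate.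
      have : 1 / (x j - y) * (1 / (x i - y)) =
          1 / (x j - y) * (1 / (x i - x j)) + 1 / (x i - y) * (1 / (x j - x i)) := by
        rw [← neg_sub (x i) (x j)]
        field_simp
        ring
      linear_combination (b j * b i *
        ∏ k ∈ S.erase i, (a k + b k * (1 / (x k - x i)))) * this
    simp only [Finset.sum_add_distrib] at key ⊢
    rw [key]
    have : ∑ i ∈ S, a j * (1 / (x i - y) *
          (b i * ∏ k ∈ S.erase i, (a k + b k * (1 / (x k - x i))))) =
        ∑ i ∈ S, 1 / (x i - y) * (b i * (a j *
          ∏ k ∈ S.erase i, (a k + b k * (1 / (x k - x i))))) :=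
      Finset.sum_congr rfl fun i _ => by ring
    rw [this]
    ring

/-- The determinant of a matrix whose `i`-th row is a unit vector. -/
theorem det_updateRow_single_eq {ι R : Type*} [Fintype ι] [DecidableEq ι] [CommRing R]
    (A : Matrix ι ι R) (i : ι) :
    (A.updateRow i (Pi.single i 1)).det =
      (A.submatrix (Subtype.val : {k // k ≠ i} → ι) Subtype.val).det := by
  rw [Matrix.twoBlockTriangular_det _ (fun k => k ≠ i)]
  · have : Unique {k // ¬ k ≠ i} := ⟨⟨⟨i, by simp⟩⟩, fun k => Subtype.ext (not_not.1 k.2)⟩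
    have h (k : {k // ¬ k ≠ i}) : k.1 = i := not_not.1 k.2
    rw [Matrix.det_unique (n := {k // ¬ k ≠ i})]
    simp only [Matrix.toSquareBlockProp_def, Matrix.of_apply, h, Matrix.updateRow_self,
      Pi.single_eq_same, mul_one]
    congr 1
    ext k l
    simp [Matrix.updateRow_ne k.2]
  · intro k hk l hl
    obtain rfl : k = i := not_not.1 hk
    simp [hl]

/-- Partial fraction expansion of `det (A + diag (1 / (x i - y)))`. -/
theorem det_add_diagonal_inv_sub {ι : Type*} [Fintype ι] [DecidableEq ι] (A : Matrix ι ι ℂ)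
    (x : ι → ℂ) (hx : Function.Injective x) (y : ℂ) (hy : ∀ i, x i ≠ y) :
    (A + Matrix.diagonal fun i => 1 / (x i - y)).det = A.det + ∑ i, 1 / (x i - y) *
      ((A + Matrix.diagonal fun k => 1 / (x k - x i)).submatrix
        (Subtype.val : {k // k ≠ i} → ι) Subtype.val).det := by
  simp only [← det_updateRow_single_eq]
  simp only [Matrix.det_apply', Finset.mul_sum]
  rw [Finset.sum_comm, ← Finset.sum_add_distrib]
  refine Finset.sum_congr rfl fun σ _ => ?_
  -- In the Leibniz term of `σ`, exactly the fixed points of `σ` contribute a pole.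
  have h := prod_add_div_sub_eq Finset.univ x (fun i => A (σ i) i)
    (fun i => if σ i = i then 1 else 0) hx y hy
  have e (z : ℂ) (k : ι) : (A + Matrix.diagonal fun i => 1 / (x i - z)) (σ k) k =
      A (σ k) k + (if σ k = k then 1 else 0) * (1 / (x k - z)) := by
    by_cases hk : σ k = k <;> simp [hk, Matrix.diagonal]
  simp only [e]
  rw [h, mul_add, Finset.mul_sum]
  congr 1
  refine Finset.sum_congr rfl fun i _ => ?_
  rw [mul_left_comm]
  congr 2
  rw [← Finset.mul_prod_erase Finset.univ _ (Finset.mem_univ i)]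
  by_cases hi : σ i = i
  · simp only [hi, if_true, one_mul, Matrix.updateRow_self, Pi.single_eq_same]
    refine Finset.prod_congr rfl fun k hk => ?_
    have : σ k ≠ i := fun h => (Finset.ne_of_mem_erase hk) (σ.injective (h.trans hi.symm))
    rw [Matrix.updateRow_ne this, e]
  -- No pole at `x i` on the left; on the right the unit row `i` is hit in column `σ⁻¹ i ≠ i`, where
  -- it vanishes.
  · have hi' : σ.symm i ≠ i := fun h => hi (by rw [Equiv.symm_apply_eq] at h; exact h.symm)
    rw [if_neg hi, zero_mul]
    by_cases h0 : ∃ k ∈ Finset.univ.erase i, σ k = i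
    · obtain ⟨k, hk, hk'⟩ := h0
      rw [Finset.prod_eq_zero hk, mul_zero]
      rw [hk', Matrix.updateRow_self, Pi.single_eq_of_ne (Finset.ne_of_mem_erase hk)]
    · exact absurd ⟨σ.symm i, by simpa using hi', by simp⟩ h0

/-! ### Rectangular permanents and Lascoux's formula -/

/-- Frees the sum from the particular `Fintype` instance chosen in the definition. -/
theorem rectPermanent_eq_sum {ι κ : Type*} [Fintype ι] [Fintype κ] [inst : Fintype (ι ↪ κ)]
    (A : Matrix ι κ ℂ) : rectPermanent A = ∑ f : ι ↪ κ, ∏ i, A i (f i) := by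
  unfold rectPermanent
  congr!

theorem rectPermanent_submatrix_equiv {ι κ κ' : Type*} [Fintype ι] [Fintype κ] [Fintype κ']
    (A : Matrix ι κ ℂ) (e : κ' ≃ κ) :
    rectPermanent (A.submatrix id e) = rectPermanent A := by
  classical
  rw [rectPermanent_eq_sum, rectPermanent_eq_sum]
  refine Fintype.sum_equiv (Equiv.embeddingCongr (Equiv.refl ι) e) _ _ fun f => ?_
  simp [Equiv.embeddingCongr]

/-- Expansion of a rectangular permanent with respect to a column. -/
theorem rectPermanent_option {ι κ : Type*} [Fintype ι] [Fintype κ] [DecidableEq ι]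
    (A : Matrix ι (Option κ) ℂ) :
    rectPermanent A = rectPermanent (Matrix.of fun i j => A i (some j)) +
      ∑ i, A i none * rectPermanent (Matrix.of fun (k : {k // k ≠ i}) j => A k.1 (some j)) := by
  classical
  simp only [rectPermanent_eq_sum]
  -- An injection either avoids the new column or uses it in exactly one row `i`.
  let e : (ι ↪ Option κ) → (ι ↪ κ) ⊕ (Σ i : ι, {k // k ≠ i} ↪ κ) := fun f =>
    if h : ∃ i, f i = none then
      Sum.inr ⟨h.choose, ⟨fun k => (f k.1).get (Option.isSome_iff_ne_none.2 fun hk =>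
          k.2 (f.injective (hk.trans h.choose_spec.symm))),
        fun k l hkl => Subtype.ext (f.injective (Option.get_inj.1 hkl))⟩⟩
    else Sum.inl ⟨fun k => (f k).get (Option.isSome_iff_ne_none.2 fun hk => h ⟨k, hk⟩),
        fun k l hkl => f.injective (Option.get_inj.1 hkl)⟩
  let g : (ι ↪ κ) ⊕ (Σ i : ι, {k // k ≠ i} ↪ κ) → (ι ↪ Option κ) := Sum.elim
    (fun f => f.trans Function.Embedding.some)
    (fun p => ⟨fun k => if h : k ≠ p.1 then some (p.2 ⟨k, h⟩) else none, by
      intro k l hkl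
      by_cases hk : k ≠ p.1 <;> by_cases hl : l ≠ p.1
      · simpa [hk, hl] using hkl
      · simp [hk, hl] at hkl
      · simp [hk, hl] at hkl
      · exact (not_not.1 hk).trans (not_not.1 hl).symm⟩)
  have hg : Function.Bijective g := by
    constructor
    · rintro (f | ⟨i, f⟩) (f' | ⟨i', f'⟩) h
      · congr 1
        ext k
        have := DFunLike.congr_fun h k
        simpa [g] using this
      · have := DFunLike.congr_fun h i'
        simp [g] at this
      · have := DFunLike.congr_fun h i
        simp [g] at this
      · have := DFunLike.congr_fun h i
        have hi : i = i' := by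
          by_contra hi
          simp [g, hi] at this
        subst hi
        congr 2
        ext k
        have := DFunLike.congr_fun h k.1
        simpa [g, k.2] using this
    · intro f
      refine ⟨e f, ?_⟩
      ext1 k
      by_cases h : ∃ i, f i = none
      · simp only [e, dif_pos h, g, Sum.elim_inr]
        by_cases hk : k = h.choose
        · simp only [Function.Embedding.coeFn_mk]
          rw [dif_neg (not_not.2 hk)]
          exact ((congrArg f hk).trans h.choose_spec).symm
        · simp only [Function.Embedding.coeFn_mk]
          rw [dif_pos hk]
          exact Option.some_get _
      · simp only [e, dif_neg h, g, Sum.elim_inl]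
        exact Option.some_get _
  let E := Equiv.ofBijective g hg
  rw [← E.sum_comp, Fintype.sum_sum_type]
  congr 1
  rw [Fintype.sum_sigma]
  refine Fintype.sum_congr _ _ fun i => ?_
  rw [Finset.mul_sum]
  refine Fintype.sum_congr _ _ fun f => ?_
  rw [← Finset.mul_prod_erase Finset.univ _ (Finset.mem_univ i)]
  congr 1
  · simp [E, g]
  · rw [Finset.prod_subtype (Finset.univ.erase i) (p := fun k => k ≠ i) (by simp)]
    refine Fintype.prod_congr _ _ fun k => ?_
    simp [E, g, k.2]

/-- Lascoux's formula: the permanent of `1 / (x i - y j)` is a determinant indexed by the rows. -/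
theorem rectPermanent_cauchy {κ : Type*} [Fintype κ] (y : κ → ℂ) {ι : Type*} [Fintype ι]
    [DecidableEq ι] (x : ι → ℂ) (hx : Function.Injective x) (hxy : ∀ i j, x i ≠ y j) :
    rectPermanent (Matrix.of fun i j => 1 / (x i - y j)) =
      ((Matrix.of fun i k => 1 / (x i - x k)) +
        Matrix.diagonal fun i => ∑ j, 1 / (x i - y j) - ∑ k, 1 / (x i - x k)).det := by
  revert y ι
  refine Fintype.induction_empty_option (P := fun κ [Fintype κ] => ∀ (y : κ → ℂ) {ι : Type _}
    [Fintype ι] [DecidableEq ι] (x : ι → ℂ), Function.Injective x → (∀ i j, x i ≠ y j) →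
    rectPermanent (Matrix.of fun i j => 1 / (x i - y j)) =
      ((Matrix.of fun i k => 1 / (x i - x k)) +
        Matrix.diagonal fun i => ∑ j, 1 / (x i - y j) - ∑ k, 1 / (x i - x k)).det) ?_ ?_ ?_ κ
  · intro κ κ' _ e ih y ι _ _ x hx hxy
    let := Fintype.ofEquiv κ' e.symm
    have h := ih (y ∘ e) x hx fun i j => hxy i (e j)
    rw [← rectPermanent_submatrix_equiv _ e]
    refine Eq.trans ?_ (h.trans ?_)
    · rfl
    · congr 3
      funext i
      rw [← e.sum_comp]
      rfl
  · intro y ι _ _ x hx _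
    classical
    rw [rectPermanent_eq_sum]
    rcases isEmpty_or_nonempty ι with hι | ⟨⟨i⟩⟩
    · simp
    · have : IsEmpty (ι ↪ PEmpty) := ⟨fun f => (f i).elim⟩
      rw [Fintype.sum_empty, eq_comm, ← Matrix.exists_mulVec_eq_zero_iff]
      -- Without any `y` all row sums vanish, so the all-ones vector lies in the kernel.
      refine ⟨1, fun h => one_ne_zero (congrFun h i), ?_⟩
      ext k
      simp only [Matrix.add_mulVec, Pi.add_apply, Matrix.mulVec_diagonal]
      simp [Matrix.mulVec, dotProduct]
  · intro κ _ ih y ι _ _ x hx hxy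
    rw [rectPermanent_option]
    have h0 := ih (fun j => y (some j)) x hx fun i j => hxy i (some j)
    have hi (i : ι) := ih (fun j => y (some j)) (fun k : {k // k ≠ i} => x k.1)
      (hx.comp Subtype.val_injective) fun k j => hxy k.1 (some j)
    simp only [Matrix.of_apply]
    rw [h0]
    simp only [hi, Fintype.sum_option]
    have e : (Matrix.of fun i k => 1 / (x i - x k)) + (Matrix.diagonal fun i =>
          1 / (x i - y none) + ∑ j, 1 / (x i - y (some j)) - ∑ k, 1 / (x i - x k)) =
        ((Matrix.of fun i k => 1 / (x i - x k)) + Matrix.diagonal fun i =>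
          ∑ j, 1 / (x i - y (some j)) - ∑ k, 1 / (x i - x k)) +
        Matrix.diagonal fun i => 1 / (x i - y none) := by
      rw [add_assoc, Matrix.diagonal_add]
      congr 2
      funext i
      ring
    rw [e, det_add_diagonal_inv_sub _ x hx _ fun i => hxy i none]
    congr 1
    refine Fintype.sum_congr _ _ fun i => ?_
    congr 2
    rw [add_assoc, Matrix.diagonal_add]
    ext k l
    by_cases hkl : k = l
    · subst hkl
      simp only [Matrix.add_apply, Matrix.of_apply, Matrix.diagonal_apply_eq,
        Matrix.submatrix_apply]
      -- Deleting the index `i` removes `1 / (x k - x i)` from the subtracted sum, which is exactly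
      -- what the residue at `x i` adds.
      rw [Fintype.sum_eq_add_sum_subtype_ne (fun l => 1 / (x k.1 - x l)) i]
      ring
    · have : k.1 ≠ l.1 := fun h => hkl (Subtype.ext h)
      simp [hkl, this]

/-! ### The determinant in the monomial basis -/

theorem sum_range_ite_lt_linear (n j : ℕ) (hj : j < n) (α β : ℂ) :
    ∑ k ∈ Finset.range n, (if j < k then α + β * k else 0) =
      (n - 1 - j) * α + β * (n * (n - 1) / 2 - j * (j + 1) / 2) := by
  induction n, hj using Nat.le_induction with
  | base =>
    rw [Finset.sum_eq_zero]
    · push_cast; ring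
    · intro k hk
      rw [if_neg (by have := Finset.mem_range.1 hk; omega)]
  | succ n hn ih =>
    rw [Finset.sum_range_succ, ih, if_pos (by omega)]
    push_cast; ring

theorem sum_range_cast (n : ℕ) : ∑ k ∈ Finset.range n, (k : ℂ) = n * (n - 1) / 2 := by
  induction n with
  | zero => simp
  | succ n ih => rw [Finset.sum_range_succ, ih]; push_cast; ring

theorem sum_range_cast_sq (n : ℕ) :
    ∑ k ∈ Finset.range n, (k : ℂ) ^ 2 = n * (n - 1) * (2 * n - 1) / 6 := by
  induction n with
  | zero => simp
  | succ n ih => rw [Finset.sum_range_succ, ih]; push_cast; ring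

/-- The matrix, in the monomial basis, of the operator `f ↦ c f + μ f - X f'` on polynomials
modulo `X ^ n - 1`, where `μ` takes the value `-2 / (ω - 1)` at the `n`-th roots of unity `ω ≠ 1`
and the value `n s - (n - 1)` at `1`. -/
noncomputable def circulantDiffMatrix (n : ℕ) (c s : ℂ) : Matrix (Fin n) (Fin n) ℂ :=
  Matrix.of fun j k => (if j = k then c - k else 0) +
    (s - 2 / n * ((j : ℂ) - k + if (j : ℕ) < k then (n : ℂ) else 0))

/-- The value of `circulantDiffMatrix` for generic `c`. -/
theorem det_circulantDiffMatrix_of_ne (p : ℕ) (c s : ℂ) (h1 : c - p ≠ 0) (h2 : c - p - 1 ≠ 0) :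
    (circulantDiffMatrix (p + 2) c s).det = (∏ k ∈ Finset.range p, (c - k)) *
      (-((c - p - 1) * (c - p)) -
        (s * ((p + 2) * (c + 1) - (p + 2) * (p + 1) / 2) + (c + 1) * (p + 1)
          - (p + 1) * (2 * p + 3) / 3) +
        2 * ((c + 1) - (p + 1) / 2) * ((p + 2) * s + c - p - 1)) := by
  -- The jump for `j < k` in the circulant part contributes `-2` and goes into the triangular `U`;
  -- what remains, `s + (2 / n) k - (2 / n) j` with `n = p + 2`, has rank at most two.
  set U : Matrix (Fin (p + 2)) (Fin (p + 2)) ℂ :=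
    Matrix.of fun j k => (if j = k then c - k else 0) - if (j : ℕ) < k then 2 else 0 with hU
  -- `U` maps the vector `c + 1 - k` to the constant `(c - p) (c - p - 1)`, and the constant `1` to
  -- `j - t'`. So the columns of `Y` are the preimages under `U` of `1` and `j`.
  set t : ℂ := 1 / ((c - p) * (c - p - 1)) with ht
  set t' : ℂ := 2 * p + 2 - c with ht'
  set Y : Matrix (Fin (p + 2)) (Fin 2) ℂ := Matrix.of fun k r =>
    (![t * (c + 1 - k), 1 + t' * (t * (c + 1 - k))] : Fin 2 → ℂ) r with hY
  set V : Matrix (Fin 2) (Fin (p + 2)) ℂ := Matrix.of fun r k =>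
    (![s + 2 / (p + 2) * k, -2 / (p + 2)] : Fin 2 → ℂ) r with hV
  have hp : (p : ℂ) + 2 ≠ 0 := by exact_mod_cast (show p + 2 ≠ 0 by omega)
  have hUY (j : Fin (p + 2)) (α β : ℂ) : ∑ k, U j k * (α + β * k) = (c - j) * (α + β * j) -
      2 * ((p + 1 - j) * α + β * ((p + 2) * (p + 1) / 2 - j * (j + 1) / 2)) := by
    have e := sum_range_ite_lt_linear (p + 2) j j.2 α β
    rw [← Fin.sum_univ_eq_sum_range (fun k => if j.1 < k then α + β * (k : ℂ) else 0)] at e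
    have : ∀ k, U j k * (α + β * k) = (if j = k then (c - k) * (α + β * k) else 0) -
        2 * (if (j : ℕ) < k then α + β * k else 0) := by
      intro k
      simp only [hU, Matrix.of_apply]
      split_ifs <;> ring
    simp only [this]
    rw [Finset.sum_sub_distrib, ← Finset.mul_sum, e, Finset.sum_ite_eq]
    simp only [Finset.mem_univ, if_true]
    push_cast; ring
  have htt : t * ((c - p) * (c - p - 1)) = 1 := by rw [ht]; field_simp
  have hUY' : U * Y = Matrix.of fun (j : Fin (p + 2)) (r : Fin 2) => (![1, (j : ℂ)] : Fin 2 → ℂ) r := by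
    ext j r
    rw [Matrix.mul_apply]
    fin_cases r
    · have := hUY j (t * (c + 1)) (-t)
      simp only [hY, Matrix.of_apply, Fin.zero_eta, Matrix.cons_val_zero]
      rw [Finset.sum_congr rfl fun k _ => by
        rw [show t * (c + 1 - (k : ℂ)) = t * (c + 1) + -t * k by ring], this]
      linear_combination htt
    · have := hUY j (1 + t' * (t * (c + 1))) (-(t' * t))
      simp only [hY, Matrix.of_apply, Fin.mk_one, Matrix.cons_val_one, Matrix.cons_val_zero]
      rw [Finset.sum_congr rfl fun k _ => by
        rw [show 1 + t' * (t * (c + 1 - (k : ℂ))) =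
          (1 + t' * (t * (c + 1))) + -(t' * t) * k by ring], this]
      linear_combination t' * htt
  have hT : circulantDiffMatrix (p + 2) c s = U * (1 + Y * V) := by
    rw [Matrix.mul_add, Matrix.mul_one, ← Matrix.mul_assoc, hUY']
    ext j k
    simp only [circulantDiffMatrix, Matrix.add_apply, Matrix.mul_apply, Fin.sum_univ_two,
      Matrix.of_apply, hU, hV, Matrix.cons_val_one, Matrix.cons_val_zero]
    push_cast
    split_ifs <;> field_simp <;> ring
  have hdetU : U.det = ∏ k ∈ Finset.range (p + 2), (c - k) := by
    rw [Matrix.det_of_isUpperTriangular, Finset.prod_range]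
    · simp [hU]
    · intro j k hjk
      have hjk' : k < j := hjk
      simp [hU, hjk'.le, hjk'.ne']
  have hsum (α β γ : ℂ) : ∑ k : Fin (p + 2), (α + β * (k : ℂ) + γ * (k : ℂ) ^ 2) =
      (p + 2) * α + β * ((p + 2) * (p + 1) / 2) + γ * ((p + 2) * (p + 1) * (2 * p + 3) / 6) := by
    rw [Fin.sum_univ_eq_sum_range (fun k => α + β * (k : ℂ) + γ * (k : ℂ) ^ 2)]
    rw [Finset.sum_add_distrib, Finset.sum_add_distrib, ← Finset.mul_sum, ← Finset.mul_sum,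
      sum_range_cast, sum_range_cast_sq]
    simp
    ring
  have h00 : (V * Y) 0 0 = t * (s * ((p + 2) * (c + 1) - (p + 2) * (p + 1) / 2) +
      (c + 1) * (p + 1) - (p + 1) * (2 * p + 3) / 3) := by
    have := hsum (s * t * (c + 1)) (2 / (p + 2) * t * (c + 1) - s * t) (-(2 / (p + 2) * t))
    rw [Matrix.mul_apply]
    refine Eq.trans (Finset.sum_congr rfl fun k _ => ?_) (this.trans ?_)
    · simp [hV, hY]; ring
    · field_simp; ring
  have h10 : (V * Y) 1 0 = - (t * (2 * ((c + 1) - (p + 1) / 2))) := by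
    have := hsum (-2 / (p + 2) * t * (c + 1)) (2 / (p + 2) * t) 0
    rw [Matrix.mul_apply]
    refine Eq.trans (Finset.sum_congr rfl fun k _ => ?_) (this.trans ?_)
    · simp [hV, hY]; ring
    · field_simp; ring
  have h01 : (V * Y) 0 1 = (p + 2) * s + p + 1 + t' * (V * Y) 0 0 := by
    have := hsum s (2 / (p + 2)) 0
    have e : (p + 2) * s + p + 1 = ∑ k : Fin (p + 2), (s + 2 / (p + 2) * (k : ℂ)) := by
      refine Eq.trans ?_ (this.symm.trans (Finset.sum_congr rfl fun k _ => by ring))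
      field_simp; ring
    rw [Matrix.mul_apply, Matrix.mul_apply, e, Finset.mul_sum, ← Finset.sum_add_distrib]
    refine Finset.sum_congr rfl fun k _ => ?_
    simp [hV, hY]; ring
  have h11 : (V * Y) 1 1 = -2 + t' * (V * Y) 1 0 := by
    have := hsum (-2 / (p + 2)) 0 0
    have e : (-2 : ℂ) = ∑ k : Fin (p + 2), (-2 / ((p : ℂ) + 2)) := by
      simp; field_simp
    rw [Matrix.mul_apply, Matrix.mul_apply, e, Finset.mul_sum, ← Finset.sum_add_distrib]
    refine Finset.sum_congr rfl fun k _ => ?_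
    simp [hV, hY]; ring
  rw [hT, Matrix.det_mul, Matrix.det_one_add_mul_comm, Matrix.det_fin_two, hdetU]
  simp only [Matrix.add_apply, Matrix.one_apply_eq, ne_eq, zero_ne_one, not_false_eq_true,
    Matrix.one_apply_ne, one_ne_zero]
  rw [h11, h01, h10, h00, Finset.prod_range_succ, Finset.prod_range_succ, ht, ht']
  push_cast
  field_simp
  ring

/-- Both sides are continuous in `c`, and the two excluded values have dense complement. -/
theorem det_circulantDiffMatrix (p : ℕ) (c s : ℂ) :
    (circulantDiffMatrix (p + 2) c s).det = (∏ k ∈ Finset.range p, (c - k)) *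
      (-((c - p - 1) * (c - p)) -
        (s * ((p + 2) * (c + 1) - (p + 2) * (p + 1) / 2) + (c + 1) * (p + 1)
          - (p + 1) * (2 * p + 3) / 3) +
        2 * ((c + 1) - (p + 1) / 2) * ((p + 2) * s + c - p - 1)) := by
  have hd : Dense (({(p : ℂ), (p : ℂ) + 1} : Set ℂ)ᶜ) :=
    Set.Countable.dense_compl ℝ (Set.toFinite _).countable
  refine congrFun (Continuous.ext_on hd ?_ ?_ (f := fun c => (circulantDiffMatrix (p + 2) c s).det)
    (g := fun c => (∏ k ∈ Finset.range p, (c - k)) *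
      (-((c - p - 1) * (c - p)) -
        (s * ((p + 2) * (c + 1) - (p + 2) * (p + 1) / 2) + (c + 1) * (p + 1)
          - (p + 1) * (2 * p + 3) / 3) +
        2 * ((c + 1) - (p + 1) / 2) * ((p + 2) * s + c - p - 1))) ?_) c
  · refine Continuous.matrix_det (continuous_matrix fun j k => ?_)
    simp only [circulantDiffMatrix, Matrix.of_apply]
    split_ifs <;> fun_prop
  · fun_prop
  · intro c hc
    simp only [Set.mem_compl_iff, Set.mem_insert_iff, Set.mem_singleton_iff, not_or] at hc
    exact det_circulantDiffMatrix_of_ne p c s (sub_ne_zero.2 hc.1)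
      (by rw [sub_sub]; exact sub_ne_zero.2 hc.2)

/-! ### Values and logarithmic derivatives of `arithPoly` at roots of unity -/

theorem sub_one_mul_geom (N : ℕ) (x : ℂ) : (x - 1) * ∑ l ∈ Finset.range N, x ^ l = x ^ N - 1 := by
  rw [mul_comm, geom_sum_mul]

theorem sub_one_sq_mul_sum_mul_pow (N : ℕ) (x : ℂ) :
    (x - 1) ^ 2 * ∑ l ∈ Finset.range N, (l : ℂ) * x ^ l =
      (x - 1) * N * x ^ N - x * (x ^ N - 1) := by
  induction N with
  | zero => simp
  | succ N ih => rw [Finset.sum_range_succ, mul_add, ih]; push_cast; ring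

theorem sub_one_cube_mul_sum_sq_mul_pow (N : ℕ) (x : ℂ) :
    (x - 1) ^ 3 * ∑ l ∈ Finset.range N, (l : ℂ) ^ 2 * x ^ l =
      (x - 1) ^ 2 * N ^ 2 * x ^ N - 2 * N * x * (x - 1) * x ^ N + x * (x + 1) * (x ^ N - 1) := by
  induction N with
  | zero => simp
  | succ N ih => rw [Finset.sum_range_succ, mul_add, ih]; push_cast; ring

theorem eval_arithPoly (m n : ℕ) (a x : ℂ) :
    (arithPoly m n a).eval x = ∑ l ∈ Finset.range (m * n), (l : ℂ) * x ^ l +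
      a * ∑ l ∈ Finset.range (m * n), x ^ l := by
  simp only [arithPoly, eval_finsetSum, eval_mul, eval_C, eval_pow, eval_X, add_mul,
    Finset.sum_add_distrib, Finset.mul_sum]

theorem mul_eval_derivative_arithPoly (m n : ℕ) (a x : ℂ) :
    x * (derivative (arithPoly m n a)).eval x =
      ∑ l ∈ Finset.range (m * n), (l : ℂ) ^ 2 * x ^ l +
        a * ∑ l ∈ Finset.range (m * n), (l : ℂ) * x ^ l := by
  simp only [arithPoly, derivative_sum, derivative_C_mul_X_pow, eval_finsetSum, eval_mul, eval_C,
    eval_pow, eval_X, Finset.mul_sum, ← Finset.sum_add_distrib]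
  refine Finset.sum_congr rfl fun l _ => ?_
  rcases l with _ | l
  · simp
  · simp only [Nat.add_sub_cancel]; push_cast; ring

/-- The geometric sum vanishes at `x`, so `a` drops out. -/
theorem eval_arithPoly_of_pow_eq_one {m n : ℕ} (a : ℂ) {x : ℂ} (hx : x ^ n = 1) (hx1 : x ≠ 1) :
    (arithPoly m n a).eval x = m * n / (x - 1) := by
  have hN : x ^ (m * n) = 1 := by rw [mul_comm, pow_mul, hx, one_pow]
  have h1 : x - 1 ≠ 0 := sub_ne_zero.2 hx1
  have e0 := sub_one_mul_geom (m * n) x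
  have e1 := sub_one_sq_mul_sum_mul_pow (m * n) x
  rw [hN, sub_self] at e0 e1
  rw [eval_arithPoly, eq_div_iff h1]
  have e0' := (mul_eq_zero.1 e0).resolve_left h1
  rw [e0']
  refine mul_left_cancel₀ h1 ?_
  push_cast at e1
  linear_combination e1

theorem eval_one_arithPoly (m n : ℕ) (a : ℂ) :
    (arithPoly m n a).eval 1 = m * n * (m * n + 2 * a - 1) / 2 := by
  rw [eval_arithPoly]
  simp only [one_pow, mul_one, sum_range_cast, Finset.sum_const, Finset.card_range, nsmul_eq_mul]
  push_cast; ring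

theorem eval_arithPoly_ne_zero {m n : ℕ} (hn : n ≠ 0) (hm : m ≠ 0) {a : ℂ}
    (ha : (m : ℂ) * n + 2 * a - 1 ≠ 0) {x : ℂ} (hx : x ^ n = 1) :
    (arithPoly m n a).eval x ≠ 0 := by
  have h : (m : ℂ) * n ≠ 0 := by exact_mod_cast mul_ne_zero hm hn
  by_cases h1 : x = 1
  · subst h1
    rw [eval_one_arithPoly]
    exact div_ne_zero (mul_ne_zero h ha) two_ne_zero
  · rw [eval_arithPoly_of_pow_eq_one a hx h1]
    exact div_ne_zero h (sub_ne_zero.2 h1)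

/-- With N = mn, the closed forms at x^N = 1 are ∑ l x^l = N/(x - 1) and ∑ l² x^l = N²/(x - 1) -
2Nx/(x - 1)². The dependence on `x` does not involve `a` or `m`, which is what makes the determinant
tractable. -/
theorem mul_logDeriv_arithPoly_of_pow_eq_one {m n : ℕ} (hn : n ≠ 0) (hm : m ≠ 0) (a : ℂ) {x : ℂ}
    (hx : x ^ n = 1) (hx1 : x ≠ 1) :
    x * ((derivative (arithPoly m n a)).eval x / (arithPoly m n a).eval x) =
      m * n + a - 2 - 2 / (x - 1) := by
  have h : (m : ℂ) * n ≠ 0 := by exact_mod_cast mul_ne_zero hm hn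
  have hN : x ^ (m * n) = 1 := by rw [mul_comm, pow_mul, hx, one_pow]
  have h1 : x - 1 ≠ 0 := sub_ne_zero.2 hx1
  have e1 := sub_one_sq_mul_sum_mul_pow (m * n) x
  have e2 := sub_one_cube_mul_sum_sq_mul_pow (m * n) x
  rw [hN, sub_self] at e1 e2
  push_cast at e1 e2
  rw [← mul_div_assoc, mul_eval_derivative_arithPoly, eval_arithPoly_of_pow_eq_one a hx hx1]
  field_simp
  refine mul_left_cancel₀ (pow_ne_zero 1 h1) ?_
  linear_combination e2 + a * (x - 1) * e1

theorem logDeriv_arithPoly_one {m n : ℕ} (hn : n ≠ 0) (hm : m ≠ 0) {a : ℂ}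
    (ha : (m : ℂ) * n + 2 * a - 1 ≠ 0) :
    (derivative (arithPoly m n a)).eval 1 / (arithPoly m n a).eval 1 =
      (m * n - 1) * (2 * m * n - 1 + 3 * a) / (3 * (m * n + 2 * a - 1)) := by
  have h : (m : ℂ) * n ≠ 0 := by exact_mod_cast mul_ne_zero hm hn
  have hm' := left_ne_zero_of_mul h
  have hn' := right_ne_zero_of_mul h
  have e := mul_eval_derivative_arithPoly m n a 1
  rw [one_mul] at e
  rw [e, eval_one_arithPoly]
  simp only [one_pow, mul_one, sum_range_cast, sum_range_cast_sq]
  push_cast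
  field_simp
  ring

/-! ### Roots of unity and the change of basis -/

theorem sum_pow_eq_zero_of_isPrimitiveRoot {n : ℕ} {w : ℂ} (hw : IsPrimitiveRoot w n) {l : ℕ}
    (hl : l ≠ 0) (hln : l < n) : ∑ j : Fin n, (w ^ (j : ℕ)) ^ l = 0 := by
  rw [Fin.sum_univ_eq_sum_range (fun j => (w ^ j) ^ l)]
  have h1 : w ^ l - 1 ≠ 0 := sub_ne_zero.2 (hw.pow_ne_one_of_pos_of_lt hl hln)
  refine (mul_eq_zero.1 ?_).resolve_left h1
  simp only [← pow_mul]
  simp only [mul_comm _ l, pow_mul]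
  rw [sub_one_mul_geom, ← pow_mul, mul_comm, pow_mul, hw.pow_eq_one, one_pow, sub_self]

theorem pow_injective_of_isPrimitiveRoot {n : ℕ} {w : ℂ} (hw : IsPrimitiveRoot w n) :
    Function.Injective fun i : Fin n => w ^ (i : ℕ) :=
  fun i j h => Fin.ext (hw.pow_inj i.2 j.2 h)

/-- The derivation `f ↦ X f'` modulo `X ^ n - 1`, evaluated on the monomial `X ^ k`. -/
theorem sum_pow_add_pow_div_sub {n : ℕ} {w : ℂ} (hw : IsPrimitiveRoot w n) (i : Fin n) {k : ℕ}
    (hk : k < n) : ∑ j : Fin n, ((w ^ (i : ℕ)) ^ (k + 1) + (w ^ (j : ℕ)) ^ (k + 1)) /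
      (w ^ (i : ℕ) - w ^ (j : ℕ)) = k * (w ^ (i : ℕ)) ^ k := by
  have : NeZero n := ⟨by have := i.2; omega⟩
  have hw0 (j : ℕ) : w ^ j ≠ 0 := pow_ne_zero _ (hw.ne_zero (NeZero.ne n))
  induction k with
  | zero =>
    have hadd (u v : Fin n) : w ^ ((u + v : Fin n) : ℕ) = w ^ (u : ℕ) * w ^ (v : ℕ) := by
      rw [Fin.val_add, ← pow_add, ← pow_eq_pow_mod _ hw.pow_eq_one]
    -- The involution x_j ↦ x_i² / x_j of the roots reverses the sign of each summand.
    have key : ∀ j : Fin n, (w ^ (i : ℕ) + w ^ ((i + i - j : Fin n) : ℕ)) /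
        (w ^ (i : ℕ) - w ^ ((i + i - j : Fin n) : ℕ)) =
        - ((w ^ (i : ℕ) + w ^ (j : ℕ)) / (w ^ (i : ℕ) - w ^ (j : ℕ))) := by
      intro j
      have e : w ^ ((i + i - j : Fin n) : ℕ) = w ^ (i : ℕ) * w ^ (i : ℕ) / w ^ (j : ℕ) := by
        rw [eq_div_iff (hw0 _), ← hadd, ← hadd, sub_add_cancel]
      rw [e]
      by_cases hij : w ^ (i : ℕ) - w ^ (j : ℕ) = 0
      · have hj : w ^ (i : ℕ) = w ^ (j : ℕ) := sub_eq_zero.1 hij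
        rw [hj, mul_div_cancel_right₀ _ (hw0 _)]
        simp
      · have hij' : w ^ (j : ℕ) - w ^ (i : ℕ) ≠ 0 := by
          rw [← neg_sub]; exact neg_ne_zero.2 hij
        have h1 := hw0 i
        have h2 := hw0 j
        have e2 : w ^ (i : ℕ) - w ^ (i : ℕ) * w ^ (i : ℕ) / w ^ (j : ℕ) =
          - (w ^ (i : ℕ) / w ^ (j : ℕ) * (w ^ (i : ℕ) - w ^ (j : ℕ))) := by field_simp; ring
        rw [e2]
        field_simp
        ring
    have h := (Equiv.subLeft (i + i)).sum_comp fun j : Fin n =>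
      (w ^ (i : ℕ) + w ^ (j : ℕ)) / (w ^ (i : ℕ) - w ^ (j : ℕ))
    simp only [Equiv.subLeft_apply, key, Finset.sum_neg_distrib] at h
    simp only [zero_add, pow_one, Nat.cast_zero, zero_mul]
    exact self_eq_neg.1 h.symm
  | succ k ih =>
    have h0 := sum_pow_eq_zero_of_isPrimitiveRoot hw (Nat.succ_ne_zero k) hk
    -- The term `j = i` is `0` by division by zero; the `if` compensates for it and raises `k` by
    -- one.
    have e : ∀ j : Fin n, ((w ^ (i : ℕ)) ^ (k + 1 + 1) + (w ^ (j : ℕ)) ^ (k + 1 + 1)) /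
        (w ^ (i : ℕ) - w ^ (j : ℕ)) = w ^ (i : ℕ) * (((w ^ (i : ℕ)) ^ (k + 1) +
          (w ^ (j : ℕ)) ^ (k + 1)) / (w ^ (i : ℕ) - w ^ (j : ℕ))) -
        ((w ^ (j : ℕ)) ^ (k + 1) - if i = j then (w ^ (i : ℕ)) ^ (k + 1) else 0) := by
      intro j
      by_cases hij : i = j
      · subst hij; simp
      · have : w ^ (i : ℕ) - w ^ (j : ℕ) ≠ 0 :=
          sub_ne_zero.2 ((pow_injective_of_isPrimitiveRoot hw).ne hij)
        rw [if_neg hij]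
        field_simp
        ring
    simp only [e, Finset.sum_sub_distrib, ← Finset.mul_sum, h0, ih (by omega), Finset.sum_ite_eq,
      Finset.mem_univ, if_true]
    push_cast
    ring

theorem sum_ite_lt_mul_pow (n k : ℕ) (hk : k ≤ n) (x : ℂ) :
    ∑ j ∈ Finset.range n, (if j < k then x ^ j else 0) = ∑ j ∈ Finset.range k, x ^ j := by
  rw [← Finset.sum_filter]
  congr 1
  ext j
  simp only [Finset.mem_filter, Finset.mem_range]
  omega

/-- Multiplication by `c + μ` minus the derivation `f ↦ X f'` modulo `X ^ n - 1`, in the monomial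
basis. -/
theorem sum_pow_mul_circulantDiffMatrix {n : ℕ} {w : ℂ} (hw : IsPrimitiveRoot w n) (i k : Fin n)
    (c s : ℂ) (L : ℂ) (hL : w ^ (i : ℕ) ≠ 1 → L = c - 2 / (w ^ (i : ℕ) - 1))
    (hL1 : w ^ (i : ℕ) = 1 → L = c + n * s - (n - 1)) :
    ∑ j : Fin n, (w ^ (i : ℕ)) ^ (j : ℕ) * circulantDiffMatrix n c s j k =
      (L - k) * (w ^ (i : ℕ)) ^ (k : ℕ) := by
  have hn : (n : ℂ) ≠ 0 := by
    have := i.2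
    exact_mod_cast (show n ≠ 0 by omega)
  set x := w ^ (i : ℕ) with hx
  have hxn : x ^ n = 1 := by rw [hx, ← pow_mul, mul_comm, pow_mul, hw.pow_eq_one, one_pow]
  have e : ∀ j : Fin n, x ^ (j : ℕ) * circulantDiffMatrix n c s j k =
      (if j = k then x ^ (k : ℕ) * (c - k) else 0) + ((s + 2 / n * k) * x ^ (j : ℕ) -
        2 / n * (j * x ^ (j : ℕ)) - 2 * (if (j : ℕ) < k then x ^ (j : ℕ) else 0)) := by
    intro j
    simp only [circulantDiffMatrix, Matrix.of_apply]
    by_cases h1 : j = k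
    · subst h1; simp; ring
    · simp only [h1, if_false]
      split_ifs <;> field_simp <;> ring
  simp only [e]
  rw [Finset.sum_add_distrib, Finset.sum_ite_eq', Finset.sum_sub_distrib, Finset.sum_sub_distrib,
    ← Finset.mul_sum, ← Finset.mul_sum, ← Finset.mul_sum,
    Fin.sum_univ_eq_sum_range (fun j => x ^ j), Fin.sum_univ_eq_sum_range (fun j => (j : ℂ) * x ^ j),
    Fin.sum_univ_eq_sum_range (fun j => if j < (k : ℕ) then x ^ j else 0),
    sum_ite_lt_mul_pow n k k.2.le]
  simp only [Finset.mem_univ, if_true]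
  by_cases h1 : x = 1
  · rw [hL1 h1, h1]
    simp only [one_pow, mul_one, sum_range_cast, Finset.sum_const, Finset.card_range, nsmul_eq_mul]
    field_simp
    ring
  · rw [hL h1]
    have h2 : x - 1 ≠ 0 := sub_ne_zero.2 h1
    have e0 := sub_one_mul_geom n x
    have e1 := sub_one_sq_mul_sum_mul_pow n x
    have e2 := sub_one_mul_geom k x
    rw [hxn, sub_self] at e0 e1
    rw [(mul_eq_zero.1 e0).resolve_left h2]
    have e1' : ∑ j ∈ Finset.range n, (j : ℂ) * x ^ j = n / (x - 1) := by
      rw [eq_div_iff h2]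
      refine mul_left_cancel₀ h2 ?_
      linear_combination e1
    rw [e1', eq_div_of_mul_eq h2 ((mul_comm _ _).trans e2)]
    field_simp
    ring

theorem roots_X_pow_sub_one {n : ℕ} {w : ℂ} (hw : IsPrimitiveRoot w n) :
    Finset.univ.val.map (fun i : Fin n => w ^ (i : ℕ)) = (X ^ n - 1 : ℂ[X]).roots := by
  have h := hw.nthRoots_eq (one_pow n)
  rw [nthRoots, C_1] at h
  rw [h, Fin.univ_val_map, List.ofFn_eq_map]
  simp only [mul_one, Multiset.range, Multiset.map_coe]
  rw [← List.map_coe_finRange_eq_range, List.map_map]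
  rfl

/-- Vieta, from the constant coefficient of X^n - 1. -/
theorem prod_pow_of_isPrimitiveRoot {n : ℕ} (hn : n ≠ 0) {w : ℂ} (hw : IsPrimitiveRoot w n) :
    ∏ i : Fin n, w ^ (i : ℕ) = (-1) ^ (n - 1) := by
  have h := (IsAlgClosed.splits (X ^ n - C 1 : ℂ[X])).coeff_zero_eq_prod_roots_of_monic
    (monic_X_pow_sub_C 1 hn)
  rw [natDegree_X_pow_sub_C, C_1, ← roots_X_pow_sub_one hw] at h
  obtain ⟨p, rfl⟩ := Nat.exists_eq_succ_of_ne_zero hn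
  have h' : (-1 : ℂ) = (-1) ^ (p + 1) * ∏ i : Fin (p + 1), w ^ (i : ℕ) := by
    have h0 : (X ^ (p + 1) - 1 : ℂ[X]).coeff 0 = -1 := by simp [coeff_X_pow]
    exact h0.symm.trans h
  have h2 : ((-1 : ℂ) ^ p) * (-1) ^ p = 1 := by rw [← mul_pow]; simp
  rw [pow_succ] at h'
  simp only [Nat.succ_eq_add_one, Nat.add_sub_cancel]
  linear_combination (-(∏ i : Fin (p + 1), w ^ (i : ℕ))) * h2 + (-1) ^ p * h'

/-- Scott-type permanents of `X ^ n - 1` as determinants in the monomial basis. -/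
theorem scottPER_X_pow_sub_one {n : ℕ} (hn : n ≠ 0) {Q : ℂ[X]}
    (hQ : ∀ x : ℂ, x ^ n = 1 → Q.eval x ≠ 0) (c s : ℂ)
    (hL : ∀ x : ℂ, x ^ n = 1 → x ≠ 1 →
      x * ((derivative Q).eval x / Q.eval x) = c - 2 / (x - 1))
    (hL1 : (derivative Q).eval 1 / Q.eval 1 = c + n * s - (n - 1)) :
    scottPER (X ^ n - 1) Q = (-1) ^ (n - 1) * (circulantDiffMatrix n c s).det := by
  set w := Complex.exp (2 * Real.pi * Complex.I / n) with hwdef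
  have hw : IsPrimitiveRoot w n := Complex.isPrimitiveRoot_exp n hn
  set x : Fin n → ℂ := fun i => w ^ (i : ℕ) with hx
  have hxn (i) : x i ^ n = 1 := by
    rw [hx, ← pow_mul, mul_comm, pow_mul, hw.pow_eq_one, one_pow]
  have hinj : Function.Injective x := pow_injective_of_isPrimitiveRoot hw
  have hQ0 : Q ≠ 0 := by
    rintro rfl
    exact hQ 1 (one_pow n) eval_zero
  have hroot (j : Q.roots.ToType) : Q.eval j.1 = 0 :=
    (mem_roots hQ0).1 (Multiset.coe_mem (x := j))
  have hxy (i) (j : Q.roots.ToType) : x i ≠ j.1 := fun h =>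
    hQ (x i) (hxn i) (by rw [h]; exact hroot j)
  rw [scottPER_eq (X ^ n - 1) Q x (fun j : Q.roots.ToType => j.1) (roots_X_pow_sub_one hw)
    Q.roots.map_univ_coe, rectPermanent_cauchy _ _ hinj hxy]
  have hlog (i) : ∑ j : Q.roots.ToType, 1 / (x i - j.1) =
      (derivative Q).eval (x i) / Q.eval (x i) := by
    rw [(IsAlgClosed.splits Q).eval_derivative_div_eval_of_ne_zero (hQ _ (hxn i))]
    conv_rhs => rw [← Q.roots.map_univ_coe, Multiset.map_map]
    rfl
  simp only [hlog]
  set M := (Matrix.of fun i k => 1 / (x i - x k)) + Matrix.diagonal fun i =>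
    (derivative Q).eval (x i) / Q.eval (x i) - ∑ k, 1 / (x i - x k) with hM
  -- Column `k` of either side lists the values at the roots of the image of X^k. The Vandermonde
  -- determinant then cancels.
  have key : M.transpose * Matrix.diagonal x * Matrix.vandermonde x =
      Matrix.vandermonde x * circulantDiffMatrix n c s := by
    ext i k
    rw [Matrix.mul_apply, Matrix.mul_apply]
    simp only [Matrix.vandermonde_apply]
    rw [sum_pow_mul_circulantDiffMatrix hw i k c s
      (x i * ((derivative Q).eval (x i) / Q.eval (x i))) (hL _ (hxn i))
      (fun h => by rw [show x i = 1 from h, one_mul, hL1])]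
    have h := sum_pow_add_pow_div_sub hw i k.2
    have e (j : Fin n) : (M.transpose * Matrix.diagonal x) i j * x j ^ (k : ℕ) =
        (if i = j then x i * ((derivative Q).eval (x i) / Q.eval (x i) -
          ∑ k, 1 / (x i - x k)) * x i ^ (k : ℕ) else 0) -
          x j ^ ((k : ℕ) + 1) / (x i - x j) := by
      rw [Matrix.mul_diagonal, Matrix.transpose_apply, hM, Matrix.add_apply, Matrix.of_apply]
      by_cases hij : i = j
      · subst hij
        simp only [Matrix.diagonal_apply_eq, sub_self, div_zero, if_true]
        ring
      · rw [Matrix.diagonal_apply_ne _ (Ne.symm hij), if_neg hij, ← neg_sub (x i) (x j)]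
        have : x i - x j ≠ 0 := sub_ne_zero.2 (hinj.ne hij)
        field_simp
        ring
    simp only [e, Finset.sum_sub_distrib, Finset.sum_ite_eq, Finset.mem_univ, if_true]
    simp only [add_div, Finset.sum_add_distrib] at h
    have h2 : ∑ j, x i ^ ((k : ℕ) + 1) / (x i - x j) =
        x i ^ ((k : ℕ) + 1) * ∑ j, 1 / (x i - x j) := by
      rw [Finset.mul_sum]
      exact Finset.sum_congr rfl fun j _ => by ring
    change ∑ j, x i ^ ((k : ℕ) + 1) / (x i - x j) + ∑ j, x j ^ ((k : ℕ) + 1) / (x i - x j) =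
      k * x i ^ (k : ℕ) at h
    change _ = (_ - _) * x i ^ (k : ℕ)
    rw [h2] at h
    linear_combination -h
  have hdet := congrArg Matrix.det key
  rw [Matrix.det_mul, Matrix.det_mul, Matrix.det_mul, Matrix.det_transpose, Matrix.det_diagonal,
    mul_comm (Matrix.vandermonde x).det] at hdet
  have hdet' := mul_right_cancel₀ (Matrix.det_vandermonde_ne_zero_iff.2 hinj) hdet
  rw [prod_pow_of_isPrimitiveRoot hn hw] at hdet'
  have h2 : ((-1 : ℂ) ^ (n - 1)) * (-1) ^ (n - 1) = 1 := by rw [← mul_pow]; simp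
  linear_combination (-1) ^ (n - 1) * hdet' - M.det * h2

/-! ### The theorem -/

theorem theorem32 (n m : ℕ) (hn : 1 ≤ n) (hm : 1 ≤ m) (a : ℂ)
    (ha : (m : ℂ) * n + 2 * a - 1 ≠ 0)
    (ha1 : n = 1 → a + m - 1 ≠ 0) :
    (∀ x ∈ (X ^ n - 1 : ℂ[X]).roots, ∀ y ∈ (arithPoly m n a).roots, x ≠ y) ∧
    scottPER (X ^ n - 1) (arithPoly m n a) =
      (-1) ^ (n - 1) * (n * ((m : ℂ) - 1) * polyV n a m / (6 * ((m : ℂ) * n + 2 * a - 1))) *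
        shiftedFactorial (a + ((m : ℂ) - 1) * n + 1) ((n : ℤ) - 2) := by
  have hn0 : n ≠ 0 := by omega
  have hm0 : m ≠ 0 := by omega
  have hnc : (n : ℂ) ≠ 0 := by exact_mod_cast hn0
  have hQ : ∀ x : ℂ, x ^ n = 1 → (arithPoly m n a).eval x ≠ 0 :=
    fun x hx => eval_arithPoly_ne_zero hn0 hm0 ha hx
  refine ⟨?_, ?_⟩
  · rintro x hx y hy rfl
    have h1 := (mem_roots'.1 hx).2
    have h2 := (mem_roots'.1 hy).2
    simp only [IsRoot.def, eval_sub, eval_pow, eval_X, eval_one] at h1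
    exact hQ x (sub_eq_zero.1 h1) h2
  · set c : ℂ := m * n + a - 2 with hc
    set l : ℂ := (m * n - 1) * (2 * m * n - 1 + 3 * a) / (3 * (m * n + 2 * a - 1)) with hl
    -- The parameter `s` is solved from the exceptional value at 1: `l = c + n s - (n - 1)`.
    rw [scottPER_X_pow_sub_one hn0 hQ c ((l - c + n - 1) / n)
      (fun x hx hx1 => mul_logDeriv_arithPoly_of_pow_eq_one hn0 hm0 a hx hx1)
      (by rw [logDeriv_arithPoly_one hn0 hm0 ha, ← hl]; field_simp; ring), mul_assoc]
    congr 1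
    obtain rfl | ⟨p, rfl⟩ : n = 1 ∨ ∃ p, n = p + 2 := by
      rcases n with _ | _ | p
      · omega
      · exact Or.inl rfl
      · exact Or.inr ⟨p, rfl⟩
    -- For n = 1 the determinant is `l`, and V_1 = 2 (a + m - 1)(3a + 2m - 1) cancels the
    -- denominator of (a + m)_{-1}.
    · have h1 : a + (m - 1) ≠ 0 := by rw [← add_sub_assoc]; exact ha1 rfl
      have hs : shiftedFactorial (a + ((m : ℂ) - 1) * (1 : ℕ) + 1) (((1 : ℕ) : ℤ) - 2) =
          1 / (a + (m - 1)) := by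
        change shiftedFactorial _ (Int.negSucc 0) = _
        simp [shiftedFactorial]
      rw [hs, Matrix.det_unique]
      simp only [circulantDiffMatrix, Matrix.of_apply, polyV]
      simp only [Nat.cast_one, mul_one] at ha ⊢
      simp [hl, hc]
      field_simp
      ring
    · have hs : shiftedFactorial (a + ((m : ℂ) - 1) * (p + 2 : ℕ) + 1) (((p + 2 : ℕ) : ℤ) - 2) =
          ∏ k ∈ Finset.range p, (c - k) := by
        rw [show ((p + 2 : ℕ) : ℤ) - 2 = Int.ofNat p by simp]
        change ∏ i ∈ Finset.range p, _ = _
        -- The shifted factorial runs upwards from `c - (p - 1)` to `c`.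
        rw [← Finset.prod_range_reflect]
        refine Finset.prod_congr rfl fun i hi => ?_
        have hi' := Finset.mem_range.1 hi
        rw [hc, Nat.sub_sub, Nat.cast_sub (by omega)]
        push_cast
        ring
      rw [hs, det_circulantDiffMatrix, mul_comm]
      congr 1
      simp only [polyV, hl, hc]
      push_cast at ha hnc ⊢
      field_simp
      ring
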